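/- Let $n,m\ge 1$ and let $s_n,k_n,s_m,k_m$ be integers with $0\le s_n\le k_n$ and $0\le s_m\le k_m$. Let $\mathcal D_n,\mathcal D_m\subseteq\mathbb R$ be sets (alphabets) containing $\{0,1\}$. If $s_n\ge 1$, let $\mathcal A_{s_n}$ be the set of all $n\times k_n$ matrices with entries in $\mathcal D_n$ each of whose rows has at most $s_n$ non-zero components; if $s_n=0$, assume $k_n=n$ and let $\mathcal A_{s_n}$ consist of the $n\times n$ identity matrix only. Define $\mathcal A_{s_m}$ in the same way with $n$ replaced by $m$, and set $$\Theta(s_n,s_m)=\{XBZ^T:\ X\in\mathcal A_{s_n},\ B\in\mathbb R^{k_n\times k_m},\ Z\in\mathcal A_{s_m}\}\subseteq\mathbb R^{n\times m}.$$ Let $\sigma>0$ and $p\in(0,1]$. For $\theta\in\mathbb R^{n\times m}$, let $\mathbb P_\theta$ be the distribution of the random matrix $Y\in\mathbb R^{n\times m}$ with entries $$Y_{ij}=E_{ij}(\theta_{ij}+\xi_{ij}),$$ where the $\xi_{ij}$ are independent $\mathcal N(0,\sigma^2)$ random variables, the $E_{ij}$ are i.i.d. Bernoulli random variables with parameter $p$,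 and $(E_{ij})$ is independent of $(\xi_{ij})$; let $\mathbb E_\theta$ be the corresponding expectation. Let $\|\cdot\|$ be the spectral norm and $n\vee m=\max(n,m)$. Then there exists an absolute constant $C'>0$ (independent of $n,m,k_n,k_m,s_n,s_m,\mathcal D_n,\mathcal D_m,p,\sigma$) such that $$\inf_{\hat\vartheta}\ \sup_{\theta\in\Theta(s_n,s_m)}\mathbb P_\theta\left\{\|\hat\vartheta-\theta\|^2\ge \frac{C'\sigma^2}{p}(n\vee m)\right\}\ge 0.1$$ and $$\inf_{\hat\vartheta}\ \sup_{\theta\in\Theta(s_n,s_m)}\mathbb E_\theta\|\hat\vartheta-\theta\|^2\ge \frac{C'\sigma^2}{p}(n\vee m),$$ where $\inf_{\hat\vartheta}$ is the infimum over all estimators, i.e. all measurable functions $\hat\vartheta=\hat\vartheta(Y)$ of $Y$ with values in $\mathbb R^{n\times m}$. -/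

import Mathlib

open MeasureTheory ProbabilityTheory
open scoped ENNReal Matrix

noncomputable section

/-- The admissible sparse factors with alphabet `D`. For `s = 0` (used only when `k = n`) this is
the singleton consisting of the identity matrix; for `s ≥ 1` it is the set of all `n × k` matrices
with entries in `D` whose rows all have at most `s` non-zero components. -/
def sparseFactors (D : Set ℝ) (n k s : ℕ) : Set (Matrix (Fin n) (Fin k) ℝ) :=
  if s = 0 then {A | ∀ i j, A i j = if (i : ℕ) = (j : ℕ) then 1 else 0}
  else {A | (∀ i j, A i j ∈ D) ∧ ∀ i, hammingNorm (A i) ≤ s}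

/-- For `s = 0` and `k = n` the only factor is the identity matrix. -/
theorem sparseFactors_zero (D : Set ℝ) (n : ℕ) :
    sparseFactors D n n 0 = {(1 : Matrix (Fin n) (Fin n) ℝ)} := by
  ext A
  simp only [sparseFactors, if_true, Set.mem_ofPred_eq, Set.mem_singleton_iff]
  constructor
  · intro h
    ext i j
    rw [h i j, Matrix.one_apply]
    simp [Fin.ext_iff]
  · rintro rfl i j
    rw [Matrix.one_apply]
    simp [Fin.ext_iff]

/-- The class of `n × m` matrices `X B Zᵀ` with sparse factors `X`, `Z` and arbitrary real `B`. -/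
def structuredClass (Dn Dm : Set ℝ) (n m kn km sn sm : ℕ) : Set (Matrix (Fin n) (Fin m) ℝ) :=
  {θ | ∃ X ∈ sparseFactors Dn n kn sn, ∃ B : Matrix (Fin kn) (Fin km) ℝ,
    ∃ Z ∈ sparseFactors Dm m km sm, θ = X * B * Zᵀ}

/-- The joint law of the mask `E` (i.i.d. Bernoulli entries with parameter `p`) and of the noise `ξ`
(i.i.d. centred Gaussian entries with variance `σ ^ 2`), `E` and `ξ` being independent. -/
def maskNoiseLaw (n m : ℕ) (p : unitInterval) (σ : ℝ) :
    Measure ((Fin n → Fin m → ℝ) × (Fin n → Fin m → ℝ)) :=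
  (Measure.pi fun _ : Fin n => Measure.pi fun _ : Fin m => bernoulliMeasure 1 0 p).prod
    (Measure.pi fun _ : Fin n => Measure.pi fun _ : Fin m => gaussianReal 0 (σ ^ 2).toNNReal)

/-- The (product, equivalently Borel) σ-algebra on real matrices. -/
instance instMeasurableSpaceRealMatrix (n m : ℕ) : MeasurableSpace (Matrix (Fin n) (Fin m) ℝ) :=
  inferInstanceAs (MeasurableSpace (Fin n → Fin m → ℝ))

/-- The observed matrix, with entries `Y i j = E i j * (θ i j + ξ i j)`. -/
def observation {n m : ℕ} (θ : Matrix (Fin n) (Fin m) ℝ)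
    (ω : (Fin n → Fin m → ℝ) × (Fin n → Fin m → ℝ)) : Matrix (Fin n) (Fin m) ℝ :=
  Matrix.of fun i j => ω.1 i j * (θ i j + ω.2 i j)

/-- The distribution `ℙ_θ` of the observed matrix `Y`. -/
def observationLaw {n m : ℕ} (p : unitInterval) (σ : ℝ)
    (θ : Matrix (Fin n) (Fin m) ℝ) : Measure (Matrix (Fin n) (Fin m) ℝ) :=
  (maskNoiseLaw n m p σ).map (observation θ)

theorem measurable_observation {n m : ℕ} (θ : Matrix (Fin n) (Fin m) ℝ) :
    Measurable (observation θ) := by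
  refine measurable_pi_lambda _ fun i => measurable_pi_lambda _ fun j => ?_
  simp only [observation, Matrix.of_apply]
  fun_prop

instance instIsProbabilityMeasureObservationLaw {n m : ℕ} (p : unitInterval) (σ : ℝ) (θ : Matrix (Fin n) (Fin m) ℝ) :
    IsProbabilityMeasure (observationLaw p σ θ) := by
  have : IsProbabilityMeasure (maskNoiseLaw n m p σ) := by
    unfold maskNoiseLaw
    infer_instance
  exact Measure.isProbabilityMeasure_map (measurable_observation θ).aemeasurable

section
open scoped Matrix.Norms.L2Operator

/-- The spectral norm of a real matrix: the operator norm with respect to Euclidean norms. -/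
def specNorm {n m : ℕ} (A : Matrix (Fin n) (Fin m) ℝ) : ℝ := ‖A‖

end

end

/-!
Assouad's method on a hypercube supported in a single line of the matrix. By transposition one may
think of `m ≤ n`, and of the first column. Rank-one matrices `δ • u vᵀ` with `0/1` vectors `u`, `v`
lie in the structured class whatever the sparsities (`indicator_mem_structuredClass`): taking for
`v` the first basis vector, the class contains every matrix whose first column is `δ` times a `0/1`
vector and whose other columns vanish.

Take `δ = σ / (4 * √p)`. Flipping one bit of `u` alters the law of one entry only. A masked entry
carries no information, so this changes the law of the observation by at most `p` times the total
variation distance of `N(0, σ²)` and `N(δ, σ²)`, and hence by at most `1/2`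
(`excessLE_observationLaw`). No estimator can then recover more than a fixed fraction of the bits,
even in probability: the average number of errors over the hypercube is at least a quarter of the
number of bits, which it never exceeds, and the reverse Markov inequality applies
(`exists_le_measureReal_hammingDist`). Each error costs at least `δ² / 4` in the squared Euclidean
norm of the first column, which the squared spectral norm dominates (`sum_col_sq_le_specNorm_sq`).
The number of bits is `max n m`, so the rate is `δ² * max n m`, of order `σ² / p * max n m`. The
bound in expectation follows from the one in probability by Markov's inequality.
-/

/-! ### Total variation and product measures -/

/-- `μ` exceeds `ν` by at most `ε` on every measurable set. For probability measures this says that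
the total variation distance of `μ` and `ν` is at most `ε`. -/
def ExcessLE {Ω : Type*} [MeasurableSpace Ω] (μ ν : Measure Ω) (ε : ℝ) : Prop :=
  ∀ A, MeasurableSet A → μ.real A ≤ ν.real A + ε

namespace ExcessLE

variable {Ω Ω' : Type*} [MeasurableSpace Ω] [MeasurableSpace Ω'] {μ ν : Measure Ω} {ε : ℝ}

theorem mono {ε' : ℝ} (h : ExcessLE μ ν ε) (hε : ε ≤ ε') : ExcessLE μ ν ε' :=
  fun A hA => (h A hA).trans (by gcongr)

theorem map (h : ExcessLE μ ν ε) {f : Ω → Ω'} (hf : Measurable f) :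
    ExcessLE (μ.map f) (ν.map f) ε := by
  intro A hA
  rw [map_measureReal_apply hf hA, map_measureReal_apply hf hA]
  exact h _ (hf hA)

theorem prod_left [IsProbabilityMeasure μ] [IsProbabilityMeasure ν] (h : ExcessLE μ ν ε)
    (ρ : Measure Ω') [IsProbabilityMeasure ρ] : ExcessLE (ρ.prod μ) (ρ.prod ν) ε := by
  intro A hA
  have key : ∀ κ : Measure Ω, IsProbabilityMeasure κ →
      Integrable (fun x => κ.real (Prod.mk x ⁻¹' A)) ρ ∧
      (ρ.prod κ).real A = ∫ x, κ.real (Prod.mk x ⁻¹' A) ∂ρ := by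
    intro κ _
    have hm : Measurable fun x => κ (Prod.mk x ⁻¹' A) := measurable_measure_prodMk_left hA
    refine ⟨Integrable.of_bound (C := 1) hm.ennreal_toReal.aestronglyMeasurable
      (.of_forall fun x => ?_), ?_⟩
    · rw [Real.norm_of_nonneg measureReal_nonneg]
      exact measureReal_le_one
    · simp only [Measure.real]
      rw [Measure.prod_apply hA, integral_toReal hm.aemeasurable
        (.of_forall fun x => measure_lt_top _ _)]
  obtain ⟨hi, he⟩ := key μ inferInstance
  obtain ⟨hi', he'⟩ := key ν inferInstance
  rw [he, he']
  calc ∫ x, μ.real (Prod.mk x ⁻¹' A) ∂ρ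
      ≤ ∫ x, (ν.real (Prod.mk x ⁻¹' A) + ε) ∂ρ :=
        integral_mono hi (hi'.add (integrable_const _)) fun x => h _ (measurable_prodMk_left hA)
    _ = _ := by rw [integral_add hi' (integrable_const _)]; simp

end ExcessLE

/-- Resampling one coordinate of a product measure replaces the corresponding factor. -/
theorem map_update_pi_prod {ι : Type*} [Fintype ι] [DecidableEq ι] {X : ι → Type*}
    [∀ i, MeasurableSpace (X i)] (μ ν : ∀ i, Measure (X i)) [∀ i, IsProbabilityMeasure (μ i)]
    [∀ i, IsProbabilityMeasure (ν i)] (i : ι) (h : ∀ j ≠ i, μ j = ν j) :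
    ((Measure.pi μ).prod (ν i)).map (fun q => Function.update q.1 i q.2) = Measure.pi ν := by
  have hmeas : Measurable fun q : (∀ j, X j) × X i => Function.update q.1 i q.2 :=
    measurable_update'
  refine (Measure.pi_eq fun s hs => ?_).symm
  rw [Measure.map_apply hmeas (MeasurableSet.univ_pi hs)]
  have : (fun q : (∀ j, X j) × X i => Function.update q.1 i q.2) ⁻¹' Set.univ.pi s
      = (Set.univ.pi (Function.update s i Set.univ)) ×ˢ s i := by
    ext q
    simp only [Set.mem_preimage, Set.mem_pi, Set.mem_univ, true_imp_iff, Set.mem_prod]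
    constructor
    · intro hq
      refine ⟨fun j => ?_, by simpa using hq i⟩
      rcases eq_or_ne j i with rfl | hj
      · simp
      · simpa [hj] using hq j
    · rintro ⟨h1, h2⟩ j
      rcases eq_or_ne j i with rfl | hj
      · simpa using h2
      · simpa [hj] using h1 j
  rw [this, Measure.prod_prod, Measure.pi_pi, ← Finset.mul_prod_erase _ _ (Finset.mem_univ i),
    ← Finset.mul_prod_erase Finset.univ (fun j => ν j (s j)) (Finset.mem_univ i)]
  simp only [Function.update_self, measure_univ, one_mul]
  rw [mul_comm]
  congr 1
  refine Finset.prod_congr rfl fun j hj => ?_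
  have hj := Finset.ne_of_mem_erase hj
  rw [Function.update_of_ne hj, h j hj]

/-- Product measures that differ in a single factor are as close as these factors are: both arise
from the same product measure by resampling one coordinate. -/
theorem ExcessLE.pi {ι : Type*} [Fintype ι] [DecidableEq ι] {X : ι → Type*}
    [∀ i, MeasurableSpace (X i)] {μ ν : ∀ i, Measure (X i)} [∀ i, IsProbabilityMeasure (μ i)]
    [∀ i, IsProbabilityMeasure (ν i)] {ε : ℝ} (i : ι) (h : ∀ j ≠ i, μ j = ν j)
    (hi : ExcessLE (μ i) (ν i) ε) : ExcessLE (Measure.pi μ) (Measure.pi ν) ε := by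
  rw [← map_update_pi_prod μ ν i h]
  conv => enter [1]; rw [← map_update_pi_prod μ μ i fun _ _ => rfl]
  exact (hi.prod_left _).map measurable_update'

/-! ### Assouad's lemma in probability -/

/-- **Assouad's lemma** in probability. If flipping one bit of the parameter changes the
distribution by at most `1/2` in total variation, then for some parameter an estimator errs in a
fixed fraction of the bits with probability at least `1/10`. The average error over the hypercube is
at least a quarter of the bits; as the error never exceeds the number of bits, the reverse Markov
inequality turns this into a bound in probability. -/
theorem exists_le_measureReal_hammingDist {ι Ω : Type*} [Fintype ι] [DecidableEq ι] [Nonempty ι]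
    [MeasurableSpace Ω] (P : (ι → Bool) → Measure Ω) [∀ ω, IsProbabilityMeasure (P ω)]
    (hP : ∀ ω i, ExcessLE (P (Function.update ω i false)) (P (Function.update ω i true)) (1 / 2))
    (ψ : Ω → ι → Bool) (hψ : Measurable ψ) :
    ∃ ω, 1 / 10 ≤ (P ω).real {x | 3 / 20 * (Fintype.card ι : ℝ) ≤ (hammingDist (ψ x) ω : ℝ)} := by
  have hψi : ∀ i b, MeasurableSet {x | ψ x i = b} := fun i b =>
    ((measurable_pi_apply i).comp hψ) (measurableSet_singleton b)
  have hne : ∀ (ω : ι → Bool) i, MeasurableSet {x | ψ x i ≠ ω i} := fun ω i => (hψi i (ω i)).compl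
  -- The average error in one bit, by pairing each parameter with its flip in that bit.
  have hbit : ∀ i, (∑ _ω : ι → Bool, (1 / 4 : ℝ)) ≤ ∑ ω, (P ω).real {x | ψ x i ≠ ω i} := by
    intro i
    set a : (ι → Bool) → ℝ := fun ω => (P ω).real {x | ψ x i ≠ ω i} with ha
    have hinv : Function.Involutive fun ω : ι → Bool => Function.update ω i (!ω i) := by
      intro ω; simp
    have hflip : ∑ ω, a (Function.update ω i (!ω i)) = ∑ ω, a ω :=
      Equiv.sum_comp hinv.toPerm a
    have hpair : ∀ ω,
        (1 / 2 : ℝ) ≤ a (Function.update ω i false) + a (Function.update ω i true) := by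
      intro ω
      have h := hP ω i _ (hψi i false)
      have hc : (P (Function.update ω i false)).real {x | ψ x i = false}
          + (P (Function.update ω i false)).real {x | ψ x i ≠ false} = 1 := by
        have := measureReal_add_measureReal_compl (μ := P (Function.update ω i false))
          (hψi i false)
        simpa [Set.compl_def] using this
      have e : {x | ψ x i ≠ true} = {x | ψ x i = false} := by ext; simp
      simp only [ha, Function.update_self, e]
      linarith
    have hsum : ∀ ω, (1 / 2 : ℝ) ≤ a ω + a (Function.update ω i (!ω i)) := by
      intro ω
      cases hω : ω i
      · have h := hpair ω
        rwa [← hω, Function.update_eq_self] at h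
      · have h := hpair ω
        rw [← hω, Function.update_eq_self, add_comm] at h
        simpa using h
    have := Finset.sum_le_sum fun ω (_ : ω ∈ Finset.univ) => hsum ω
    rw [Finset.sum_add_distrib, hflip] at this
    simp only [Finset.sum_const, nsmul_eq_mul] at this ⊢
    linarith
  obtain ⟨ω, -, hω⟩ : ∃ ω ∈ Finset.univ, (∑ _i : ι, (1 / 4 : ℝ))
      ≤ ∑ i, (P ω).real {x | ψ x i ≠ ω i} := by
    apply Finset.exists_le_of_sum_le Finset.univ_nonempty
    rw [Finset.sum_comm, Finset.sum_comm (s := Finset.univ (α := ι → Bool))]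
    exact Finset.sum_le_sum fun i _ => hbit i
  refine ⟨ω, ?_⟩
  set N : ℝ := (Fintype.card ι : ℝ) with hN
  have hNpos : 0 < N := by rw [hN]; exact_mod_cast Fintype.card_pos
  have hdist : ∀ x, (hammingDist (ψ x) ω : ℝ)
      = ∑ i, Set.indicator {x | ψ x i ≠ ω i} (fun _ => (1 : ℝ)) x := by
    intro x
    simp [hammingDist, Set.indicator_apply, Finset.card_filter]
  have hmd : Measurable fun x => (hammingDist (ψ x) ω : ℝ) := by
    simp only [hdist]
    exact Finset.measurable_sum _ fun i _ => measurable_const.indicator (hne ω i)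
  set S := {x | 3 / 20 * N ≤ (hammingDist (ψ x) ω : ℝ)} with hS
  have hSm : MeasurableSet S := measurableSet_le measurable_const hmd
  have hint : ∫ x, (hammingDist (ψ x) ω : ℝ) ∂P ω = ∑ i, (P ω).real {x | ψ x i ≠ ω i} := by
    simp only [hdist]
    rw [integral_finsetSum _ fun i _ => (integrable_const _).indicator (hne ω i)]
    refine Finset.sum_congr rfl fun i _ => ?_
    rw [integral_indicator (hne ω i)]
    simp
  have hle : ∀ x, (hammingDist (ψ x) ω : ℝ) ≤ S.indicator (fun _ => N) x + 3 / 20 * N := by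
    intro x
    by_cases hx : x ∈ S
    · rw [Set.indicator_of_mem hx]
      have : (hammingDist (ψ x) ω : ℝ) ≤ N := by
        rw [hN]; exact_mod_cast hammingDist_le_card_fintype
      linarith
    · rw [Set.indicator_of_notMem hx]
      have : ¬ 3 / 20 * N ≤ (hammingDist (ψ x) ω : ℝ) := hx
      linarith
  have hi1 : Integrable (S.indicator fun _ => N) (P ω) := (integrable_const _).indicator hSm
  have hrev : ∫ x, (hammingDist (ψ x) ω : ℝ) ∂P ω ≤ (P ω).real S * N + 3 / 20 * N := by
    calc _ ≤ ∫ x, (S.indicator (fun _ => N) x + 3 / 20 * N) ∂P ω := by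
          refine integral_mono_of_nonneg (.of_forall fun x => by positivity)
            (hi1.add (integrable_const _)) (.of_forall hle)
      _ = _ := by
          rw [integral_add hi1 (integrable_const _), integral_indicator hSm]
          simp
  rw [hint] at hrev
  have h4 : N * (1 / 4) ≤ (P ω).real S * N + 3 / 20 * N := by
    refine le_trans (le_of_eq ?_) (hω.trans hrev)
    simp [hN]
  nlinarith

/-! ### The law of a single entry -/

/-- Two Gaussian laws with common variance are close in total variation if their means are: the
inequality `exp u ≥ 1 + u`, applied to the log-likelihood ratio, bounds the difference of the
densities by the density of `N(0, σ²)` times a quadratic polynomial. -/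
theorem excessLE_gaussianReal {σ δ : ℝ} (hσ : 0 < σ) (hδ : 0 ≤ δ) :
    ExcessLE (gaussianReal 0 (σ ^ 2).toNNReal) (gaussianReal δ (σ ^ 2).toNNReal)
      (δ / σ + (δ / σ) ^ 2 / 2) := by
  intro A hA
  set v := (σ ^ 2).toNNReal with hvdef
  have hvR : (v : ℝ) = σ ^ 2 := Real.coe_toNNReal _ (by positivity)
  have hv : v ≠ 0 := (Real.toNNReal_pos.2 (by positivity)).ne'
  set r := δ / σ with hr
  have hr0 : 0 ≤ r := by positivity
  have hδr : δ = r * σ := by rw [hr]; field_simp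
  -- By `2 * |x| / σ ≤ 1 + (x / σ) ^ 2`, this `g` is at least minus the log-likelihood ratio.
  set g : ℝ → ℝ := fun x => (r / 2 + r ^ 2 / 2) + r / (2 * σ ^ 2) * x ^ 2 with hg
  have hg0 : ∀ x, 0 ≤ g x := fun x => by positivity
  have hsq : Integrable (fun x => x ^ 2) (gaussianReal 0 v) :=
    (memLp_id_gaussianReal (μ := 0) (v := v) 2).integrable_sq
  have hvar : ∫ x, x ^ 2 ∂gaussianReal 0 v = σ ^ 2 := by
    have h := variance_id_gaussianReal (μ := 0) (v := v)
    rw [variance_eq_integral aemeasurable_id] at h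
    simpa [hvR] using h
  have hgi : Integrable g (gaussianReal 0 v) := (integrable_const _).add (hsq.const_mul _)
  have hgint : ∫ x, g x ∂gaussianReal 0 v = r + r ^ 2 / 2 := by
    simp only [hg]
    rw [integral_add (integrable_const _) (hsq.const_mul _), integral_const_mul, hvar]
    simp
    field_simp
    ring
  have hreal : ∀ μ, (gaussianReal μ v).real A = ∫ x in A, gaussianPDFReal μ v x := by
    intro μ
    rw [Measure.real, gaussianReal_apply_eq_integral _ hv, ENNReal.toReal_ofReal]
    exact integral_nonneg fun x => gaussianPDFReal_nonneg _ _ _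
  have hφg : Integrable (fun x => gaussianPDFReal 0 v x * g x) := by
    rw [gaussianReal_of_var_ne_zero _ hv] at hgi
    have := (integrable_withDensity_iff_integrable_smul' (measurable_gaussianPDF 0 v)
      (.of_forall fun x => gaussianPDF_lt_top)).1 hgi
    simpa [toReal_gaussianPDF] using this
  have hpt : ∀ x, gaussianPDFReal 0 v x ≤ gaussianPDFReal δ v x + gaussianPDFReal 0 v x * g x := by
    intro x
    have h0 := gaussianPDFReal_nonneg 0 v x
    have hlr : gaussianPDFReal δ v x
        = gaussianPDFReal 0 v x * Real.exp ((2 * x * δ - δ ^ 2) / (2 * σ ^ 2)) := by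
      simp only [gaussianPDFReal, mul_assoc, ← Real.exp_add, hvR]
      congr 3
      field_simp
      ring
    have hexp := Real.add_one_le_exp ((2 * x * δ - δ ^ 2) / (2 * σ ^ 2))
    have hquad : 0 ≤ (2 * x * δ - δ ^ 2) / (2 * σ ^ 2) + g x := by
      have : (2 * x * δ - δ ^ 2) / (2 * σ ^ 2) + g x = r / 2 * (1 + x / σ) ^ 2 := by
        simp only [hg, hδr]
        field_simp
        ring
      rw [this]; positivity
    rw [hlr]
    nlinarith
  rw [hreal, hreal, ← hgint]
  have hfull : ∫ x, g x ∂gaussianReal 0 v = ∫ x, gaussianPDFReal 0 v x * g x := by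
    rw [integral_gaussianReal_eq_integral_smul hv]; rfl
  calc ∫ x in A, gaussianPDFReal 0 v x
      ≤ ∫ x in A, (gaussianPDFReal δ v x + gaussianPDFReal 0 v x * g x) :=
        integral_mono (integrable_gaussianPDFReal _ _).integrableOn
          ((integrable_gaussianPDFReal _ _).integrableOn.add hφg.integrableOn) hpt
    _ = (∫ x in A, gaussianPDFReal δ v x) + ∫ x in A, gaussianPDFReal 0 v x * g x :=
        integral_add (integrable_gaussianPDFReal _ _).integrableOn hφg.integrableOn
    _ ≤ _ := by
        rw [hfull]
        exact add_le_add le_rfl (setIntegral_le_integral hφg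
          (.of_forall fun x => mul_nonneg (gaussianPDFReal_nonneg _ _ _) (hg0 x)))

/-- The law of one observed entry `e * (t + x)`, with `e` a Bernoulli variable and `x` Gaussian. -/
noncomputable def entryLaw (p : unitInterval) (σ t : ℝ) : Measure ℝ :=
  ((bernoulliMeasure 1 0 p).prod (gaussianReal 0 (σ ^ 2).toNNReal)).map fun q => q.1 * (t + q.2)

theorem measurable_entry (t : ℝ) : Measurable fun q : ℝ × ℝ => q.1 * (t + q.2) := by fun_prop

instance instIsProbabilityMeasureEntryLaw (p : unitInterval) (σ t : ℝ) :
    IsProbabilityMeasure (entryLaw p σ t) :=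
  Measure.isProbabilityMeasure_map (measurable_entry t).aemeasurable

theorem entryLaw_real_apply (p : unitInterval) (σ t : ℝ) {A : Set ℝ} (hA : MeasurableSet A) :
    (entryLaw p σ t).real A = p * (gaussianReal t (σ ^ 2).toNNReal).real A
      + (1 - p) * (Measure.dirac (0 : ℝ)).real A := by
  set N := gaussianReal 0 (σ ^ 2).toNNReal
  have hfib : ∀ e : ℝ, MeasurableSet {x : ℝ | e * (t + x) ∈ A} := fun e =>
    (show Measurable fun x : ℝ => e * (t + x) by fun_prop) hA
  have h1 : N.real {x | 1 * (t + x) ∈ A} = (gaussianReal t (σ ^ 2).toNNReal).real A := by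
    have := gaussianReal_map_const_add (μ := 0) (v := (σ ^ 2).toNNReal) t
    rw [zero_add] at this
    rw [← this, map_measureReal_apply (by fun_prop) hA]
    simp [N, Set.preimage]
  have h0 : N.real {x | 0 * (t + x) ∈ A} = (Measure.dirac (0 : ℝ)).real A := by
    by_cases h : (0 : ℝ) ∈ A <;> simp [h, Measure.real, Measure.dirac_apply' _ hA]
  have hm := measurable_measure_prodMk_left (ν := N) ((measurable_entry t) hA)
  rw [entryLaw, map_measureReal_apply (measurable_entry t) hA, Measure.real,
    Measure.prod_apply ((measurable_entry t) hA),
    ← integral_toReal hm.aemeasurable (.of_forall fun _ => measure_lt_top _ _),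
    integral_bernoulliMeasure]
  simp only [smul_eq_mul]
  rw [← h1, ← h0]
  rfl

/-- Masking multiplies the total variation distance by the probability `p` of an observation. -/
theorem excessLE_entryLaw (p : unitInterval) {σ δ : ℝ} (hσ : 0 < σ) (hδ : 0 ≤ δ) :
    ExcessLE (entryLaw p σ 0) (entryLaw p σ δ) (p * (δ / σ + (δ / σ) ^ 2 / 2)) := by
  intro A hA
  rw [entryLaw_real_apply _ _ _ hA, entryLaw_real_apply _ _ _ hA]
  have := mul_le_mul_of_nonneg_left (excessLE_gaussianReal hσ hδ A hA) p.2.1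
  linarith

/-! ### The law of the observed matrix -/

theorem map_prod_pi {ι α β γ : Type*} [Fintype ι] [MeasurableSpace α] [MeasurableSpace β]
    [MeasurableSpace γ] (μ : ι → Measure α) (ν : ι → Measure β) [∀ i, IsProbabilityMeasure (μ i)]
    [∀ i, IsProbabilityMeasure (ν i)] (f : ι → α × β → γ) (hf : ∀ i, Measurable (f i)) :
    ((Measure.pi μ).prod (Measure.pi ν)).map (fun q i => f i (q.1 i, q.2 i))
      = Measure.pi fun i => ((μ i).prod (ν i)).map (f i) := by
  have (i : ι) : IsProbabilityMeasure (((μ i).prod (ν i)).map (f i)) :=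
    Measure.isProbabilityMeasure_map (hf i).aemeasurable
  rw [← (measurePreserving_arrowProdEquivProdArrow α β ι μ ν).map_eq,
    Measure.map_map (by fun_prop) (MeasurableEquiv.measurable _),
    ← Measure.pi_map_pi fun i => (hf i).aemeasurable]
  rfl

theorem observationLaw_eq_pi {n m : ℕ} (p : unitInterval) (σ : ℝ) (θ : Matrix (Fin n) (Fin m) ℝ) :
    observationLaw p σ θ = Measure.pi fun i => Measure.pi fun j => entryLaw p σ (θ i j) := by
  have row : ∀ i, Measure.pi (fun j => entryLaw p σ (θ i j)) = _ := fun i =>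
    (map_prod_pi (fun _ => bernoulliMeasure 1 0 p) (fun _ => gaussianReal 0 (σ ^ 2).toNNReal)
      (fun j q => q.1 * (θ i j + q.2)) fun j => measurable_entry _).symm
  simp only [row]
  rw [← map_prod_pi _ _ (fun i (q : (Fin m → ℝ) × (Fin m → ℝ)) j => q.1 j * (θ i j + q.2 j))
    fun i => by fun_prop]
  rfl

/-- Changing one entry of the parameter from `0` to `σ / (4 * √p)` changes the law of the
observation by at most `1/2` in total variation. -/
theorem excessLE_observationLaw {n m : ℕ} {p : unitInterval} {σ : ℝ} (hp : 0 < (p : ℝ))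
    (hσ : 0 < σ) {θ θ' : Matrix (Fin n) (Fin m) ℝ} (i : Fin n) (j : Fin m)
    (h : ∀ k l, (k, l) ≠ (i, j) → θ k l = θ' k l) (h0 : θ i j = 0)
    (h1 : θ' i j = σ / (4 * √(p : ℝ))) :
    ExcessLE (observationLaw p σ θ) (observationLaw p σ θ') (1 / 2) := by
  rw [observationLaw_eq_pi, observationLaw_eq_pi]
  have row (η : Matrix (Fin n) (Fin m) ℝ) (k : Fin n) :
      IsProbabilityMeasure (Measure.pi fun l => entryLaw p σ (η k l)) := inferInstance
  refine ExcessLE.pi (X := fun _ => Fin m → ℝ)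
    (μ := fun k => Measure.pi fun l => entryLaw p σ (θ k l))
    (ν := fun k => Measure.pi fun l => entryLaw p σ (θ' k l)) i (fun k hk => ?_)
    (ExcessLE.pi j (fun l hl => ?_) ?_)
  · congr 1
    ext1 l
    rw [h k l (by simp [hk])]
  · rw [h i l (by simp [hl])]
  · rw [h0, h1]
    refine (excessLE_entryLaw p hσ (by positivity)).mono ?_
    have hs : 0 < √(p : ℝ) := Real.sqrt_pos.2 hp
    have hs1 : √(p : ℝ) ≤ 1 := Real.sqrt_le_one.2 p.2.2
    have hsp : (p : ℝ) = √(p : ℝ) ^ 2 := (Real.sq_sqrt hp.le).symm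
    have e : (p : ℝ) * (σ / (4 * √(p : ℝ)) / σ + (σ / (4 * √(p : ℝ)) / σ) ^ 2 / 2)
        = √(p : ℝ) / 4 + 1 / 32 := by
      generalize √(p : ℝ) = s at *
      rw [hsp]
      field_simp
      ring
    rw [e]
    linarith

/-! ### Estimating a hypercube of parameters -/

/-- If the entries of `θ ω` at the positions `pos k` run through a hypercube with edge length
`σ / (4 * √p)`, the other entries not depending on the bit `ω k`, then no estimator of `θ ω` beats
the rate `σ ^ 2 / p` per position. -/
theorem exists_le_observationLaw_sum_sq {n m : ℕ} {ι : Type*} [Fintype ι] [DecidableEq ι]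
    [Nonempty ι] {p : unitInterval} {σ : ℝ} (hp : 0 < (p : ℝ)) (hσ : 0 < σ)
    (pos : ι → Fin n × Fin m) (θ : (ι → Bool) → Matrix (Fin n) (Fin m) ℝ)
    (hθ : ∀ ω k, θ ω (pos k).1 (pos k).2 = if ω k then σ / (4 * √(p : ℝ)) else 0)
    (hflip : ∀ ω k i j, (i, j) ≠ pos k →
      θ (Function.update ω k false) i j = θ (Function.update ω k true) i j)
    (ϑ : Matrix (Fin n) (Fin m) ℝ → Matrix (Fin n) (Fin m) ℝ) (hϑ : Measurable ϑ) :
    ∃ ω, ENNReal.ofReal 0.1 ≤ observationLaw p σ (θ ω)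
      {Y | 1 / 500 * σ ^ 2 / p * (Fintype.card ι : ℝ)
        ≤ ∑ k, (ϑ Y - θ ω) (pos k).1 (pos k).2 ^ 2} := by
  set δ := σ / (4 * √(p : ℝ)) with hδ
  have hδ0 : 0 < δ := by have := Real.sqrt_pos.2 hp; positivity
  have hδ2 : δ ^ 2 = σ ^ 2 / (16 * p) := by
    rw [hδ, div_pow, mul_pow, Real.sq_sqrt hp.le]; norm_num
  have hentry : ∀ k, Measurable fun Y => ϑ Y (pos k).1 (pos k).2 := fun k =>
    (measurable_pi_apply (pos k).2).comp
      ((measurable_pi_apply (X := fun _ => Fin m → ℝ) (pos k).1).comp hϑ)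
  -- Rounding the estimator at `δ / 2` turns it into an estimator of the bits.
  set ψ : Matrix (Fin n) (Fin m) ℝ → ι → Bool :=
    fun Y k => decide (δ / 2 ≤ ϑ Y (pos k).1 (pos k).2) with hψ
  have hψm : Measurable ψ := measurable_pi_lambda _ fun k =>
    measurable_to_bool (by
      have : (fun Y => ψ Y k) ⁻¹' {true} = {Y | δ / 2 ≤ ϑ Y (pos k).1 (pos k).2} := by
        ext Y; simp [hψ]
      rw [this]
      exact measurableSet_le measurable_const (hentry k))
  obtain ⟨ω, hω⟩ := exists_le_measureReal_hammingDist (fun ω => observationLaw p σ (θ ω))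
    (fun ω k => excessLE_observationLaw hp hσ (pos k).1 (pos k).2
      (fun i j hij => hflip ω k i j hij) (by simp [hθ]) (by simp [hθ, hδ])) ψ hψm
  refine ⟨ω, ?_⟩
  have hsq : ∀ Y, δ ^ 2 / 4 * (hammingDist (ψ Y) ω : ℝ)
      ≤ ∑ k, (ϑ Y - θ ω) (pos k).1 (pos k).2 ^ 2 := by
    intro Y
    have : (hammingDist (ψ Y) ω : ℝ) = ∑ k, if ψ Y k ≠ ω k then 1 else 0 := by
      simp [hammingDist, Finset.card_filter]
    rw [this, Finset.mul_sum]
    refine Finset.sum_le_sum fun k _ => ?_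
    rw [Matrix.sub_apply, hθ]
    generalize hy : ϑ Y (pos k).1 (pos k).2 = y
    have hψk : ψ Y k = decide (δ / 2 ≤ y) := by simp [hψ, hy]
    rw [hψk]
    rcases le_or_gt (δ / 2) y with h | h
    · cases ω k <;> simp [h]
      · nlinarith
      · positivity
    · cases ω k <;> simp [h.not_ge]
      · positivity
      · nlinarith
  -- The constant is `3 / 20 * 1 / 4 * 1 / 16 = 3 / 1280 ≥ 1 / 500`.
  have hle : ENNReal.ofReal (1 / 10) ≤ observationLaw p σ (θ ω)
      {Y | 3 / 20 * (Fintype.card ι : ℝ) ≤ (hammingDist (ψ Y) ω : ℝ)} :=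
    (ENNReal.ofReal_le_iff_le_toReal (measure_ne_top _ _)).2 hω
  refine le_trans (le_of_eq (by norm_num)) (hle.trans (measure_mono fun Y hY => ?_))
  refine le_trans ?_ (hsq Y)
  have hY' : 3 / 20 * (Fintype.card ι : ℝ) ≤ (hammingDist (ψ Y) ω : ℝ) := hY
  refine le_trans ?_ (mul_le_mul_of_nonneg_left hY' (by positivity))
  have hN : (0 : ℝ) ≤ Fintype.card ι := by positivity
  have : 0 ≤ σ ^ 2 / p * (Fintype.card ι : ℝ) := by positivity
  rw [hδ2]
  have e1 : 1 / 500 * σ ^ 2 / (p : ℝ) * (Fintype.card ι : ℝ)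
      = 1 / 500 * (σ ^ 2 / p * (Fintype.card ι : ℝ)) := by ring
  have e2 : σ ^ 2 / (16 * (p : ℝ)) / 4 * (3 / 20 * (Fintype.card ι : ℝ))
      = 3 / 1280 * (σ ^ 2 / p * (Fintype.card ι : ℝ)) := by field_simp; norm_num
  rw [e1, e2]
  linarith

/-! ### The spectral norm and the structured class -/

section
open scoped Matrix.Norms.L2Operator

theorem sum_col_sq_le_specNorm_sq {n m : ℕ} (A : Matrix (Fin n) (Fin m) ℝ) (j : Fin m) :
    ∑ i, A i j ^ 2 ≤ specNorm A ^ 2 := by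
  have h := A.l2_opNorm_mulVec (EuclideanSpace.single j 1)
  rw [PiLp.norm_single, norm_one, mul_one] at h
  have h2 := pow_le_pow_left₀ (norm_nonneg _) h 2
  rw [EuclideanSpace.norm_sq_eq] at h2
  simpa [specNorm] using h2

theorem specNorm_transpose {n m : ℕ} (A : Matrix (Fin n) (Fin m) ℝ) :
    specNorm Aᵀ = specNorm A := by
  rw [specNorm, specNorm, ← Matrix.conjTranspose_eq_transpose_of_trivial,
    Matrix.l2_opNorm_conjTranspose]

end

theorem sum_row_sq_le_specNorm_sq {n m : ℕ} (A : Matrix (Fin n) (Fin m) ℝ) (i : Fin n) :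
    ∑ j, A i j ^ 2 ≤ specNorm A ^ 2 :=
  (sum_col_sq_le_specNorm_sq Aᵀ i).trans_eq (by rw [specNorm_transpose])

/-- Every indicator vector is in the range of some sparse factor: of the identity if `s = 0`, and
otherwise of the factor that has this indicator as its first column. -/
theorem exists_sparseFactor_mulVec {D : Set ℝ} {n k s : ℕ} (hs : s ≤ k) (h0 : s = 0 → k = n)
    (hD : ({0, 1} : Set ℝ) ⊆ D) (u : Fin n → Bool) :
    ∃ X ∈ sparseFactors D n k s, ∃ x, X *ᵥ x = fun i => if u i then (1 : ℝ) else 0 := by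
  rcases Nat.eq_zero_or_pos s with rfl | hpos
  · obtain rfl := h0 rfl
    exact ⟨1, by rw [sparseFactors_zero]; rfl, _, Matrix.one_mulVec _⟩
  · let j₀ : Fin k := ⟨0, hpos.trans_le hs⟩
    refine ⟨Matrix.of fun i j => if u i ∧ j = j₀ then 1 else 0, ?_, Pi.single j₀ 1, ?_⟩
    · rw [sparseFactors, if_neg hpos.ne']
      refine ⟨fun i j => ?_, fun i => ?_⟩
      · rw [Matrix.of_apply]
        split_ifs
        · exact hD (by simp)
        · exact hD (by simp)
      · refine le_trans (Finset.card_le_one.2 ?_) hpos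
        intro a ha b hb
        simp at ha hb
        rw [ha.2, hb.2]
    · ext i
      simp

theorem indicator_mem_structuredClass {Dn Dm : Set ℝ} {n m kn km sn sm : ℕ}
    (hn : sn ≤ kn) (hm : sm ≤ km) (hn0 : sn = 0 → kn = n) (hm0 : sm = 0 → km = m)
    (hDn : ({0, 1} : Set ℝ) ⊆ Dn) (hDm : ({0, 1} : Set ℝ) ⊆ Dm) (δ : ℝ)
    (u : Fin n → Bool) (v : Fin m → Bool) :
    Matrix.of (fun i j => if u i && v j then δ else 0)
      ∈ structuredClass Dn Dm n m kn km sn sm := by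
  obtain ⟨X, hX, x, hx⟩ := exists_sparseFactor_mulVec hn hn0 hDn u
  obtain ⟨Z, hZ, z, hz⟩ := exists_sparseFactor_mulVec hm hm0 hDm v
  refine ⟨X, hX, δ • Matrix.vecMulVec x z, Z, hZ, ?_⟩
  rw [Matrix.mul_smul, Matrix.smul_mul, Matrix.mul_vecMulVec, Matrix.vecMulVec_mul,
    Matrix.vecMul_transpose, hx, hz]
  ext i j
  cases hu : u i <;> cases hv : v j <;> simp [Matrix.vecMulVec_apply, hu, hv]

/-- If the squared spectral norm dominates the sum of the squared entries at the positions `pos k`,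
the bound on a hypercube contained in the class gives both minimax lower bounds. -/
theorem minimax_of_hypercube {n m : ℕ} {ι : Type*} [Fintype ι] [DecidableEq ι] [Nonempty ι]
    {p : unitInterval} {σ : ℝ} (hp : 0 < (p : ℝ)) (hσ : 0 < σ)
    {T : Set (Matrix (Fin n) (Fin m) ℝ)} (pos : ι → Fin n × Fin m)
    (θ : (ι → Bool) → Matrix (Fin n) (Fin m) ℝ) (hT : ∀ ω, θ ω ∈ T)
    (hnorm : ∀ A : Matrix (Fin n) (Fin m) ℝ, ∑ k, A (pos k).1 (pos k).2 ^ 2 ≤ specNorm A ^ 2)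
    (hθ : ∀ ω k, θ ω (pos k).1 (pos k).2 = if ω k then σ / (4 * √(p : ℝ)) else 0)
    (hflip : ∀ ω k i j, (i, j) ≠ pos k →
      θ (Function.update ω k false) i j = θ (Function.update ω k true) i j) :
    (ENNReal.ofReal 0.1 ≤
      ⨅ (ϑ : Matrix (Fin n) (Fin m) ℝ → Matrix (Fin n) (Fin m) ℝ) (_ : Measurable ϑ),
        ⨆ θ ∈ T, observationLaw p σ θ
          {Y | 1 / 5000 * σ ^ 2 / (p : ℝ) * (Fintype.card ι : ℝ) ≤ specNorm (ϑ Y - θ) ^ 2}) ∧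
    (ENNReal.ofReal (1 / 5000 * σ ^ 2 / (p : ℝ) * (Fintype.card ι : ℝ)) ≤
      ⨅ (ϑ : Matrix (Fin n) (Fin m) ℝ → Matrix (Fin n) (Fin m) ℝ) (_ : Measurable ϑ),
        ⨆ θ ∈ T, ∫⁻ Y, ENNReal.ofReal (specNorm (ϑ Y - θ) ^ 2) ∂(observationLaw p σ θ)) := by
  have hr : 0 ≤ σ ^ 2 / (p : ℝ) * (Fintype.card ι : ℝ) := by positivity
  have e : ∀ c : ℝ, c * σ ^ 2 / (p : ℝ) * (Fintype.card ι : ℝ)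
      = c * (σ ^ 2 / (p : ℝ) * (Fintype.card ι : ℝ)) := fun c => by ring
  constructor
  · refine le_iInf₂ fun ϑ hϑ => ?_
    obtain ⟨ω, hω⟩ := exists_le_observationLaw_sum_sq hp hσ pos θ hθ hflip ϑ hϑ
    refine hω.trans ((measure_mono fun Y hY => ?_).trans
      (le_iSup₂ (f := fun θ (_ : θ ∈ T) => observationLaw p σ θ
        {Y | 1 / 5000 * σ ^ 2 / (p : ℝ) * (Fintype.card ι : ℝ) ≤ specNorm (ϑ Y - θ) ^ 2})
        (θ ω) (hT ω)))
    have hY' : 1 / 500 * σ ^ 2 / (p : ℝ) * (Fintype.card ι : ℝ)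
      ≤ ∑ k, (ϑ Y - θ ω) (pos k).1 (pos k).2 ^ 2 := hY
    refine le_trans ?_ (hY'.trans (hnorm _))
    rw [e, e]
    linarith
  · refine le_iInf₂ fun ϑ hϑ => ?_
    obtain ⟨ω, hω⟩ := exists_le_observationLaw_sum_sq hp hσ pos θ hθ hflip ϑ hϑ
    refine le_trans ?_ (le_iSup₂ (f := fun θ (_ : θ ∈ T) =>
      ∫⁻ Y, ENNReal.ofReal (specNorm (ϑ Y - θ) ^ 2) ∂(observationLaw p σ θ)) (θ ω) (hT ω))
    set f : Matrix (Fin n) (Fin m) ℝ → ℝ :=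
      fun Y => ∑ k, (ϑ Y - θ ω) (pos k).1 (pos k).2 ^ 2 with hf
    have hfm : Measurable f := Finset.measurable_sum _ fun k _ => by
      have : Measurable fun Y => ϑ Y (pos k).1 (pos k).2 := (measurable_pi_apply (pos k).2).comp
        ((measurable_pi_apply (X := fun _ => Fin m → ℝ) (pos k).1).comp hϑ)
      simp only [Matrix.sub_apply]
      fun_prop
    -- Markov's inequality is applied to the sum over the positions, whose measurability is plain.
    set t := 1 / 500 * σ ^ 2 / (p : ℝ) * (Fintype.card ι : ℝ) with ht
    have ht0 : 0 ≤ t := by rw [ht, e]; positivity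
    calc ENNReal.ofReal (1 / 5000 * σ ^ 2 / (p : ℝ) * (Fintype.card ι : ℝ))
        = ENNReal.ofReal t * ENNReal.ofReal 0.1 := by
          rw [← ENNReal.ofReal_mul ht0, ht, e, e]
          congr 1
          ring
      _ ≤ ENNReal.ofReal t * observationLaw p σ (θ ω)
            {Y | ENNReal.ofReal t ≤ ENNReal.ofReal (f Y)} := by
          gcongr
          exact hω.trans (measure_mono fun Y hY => ENNReal.ofReal_le_ofReal hY)
      _ ≤ ∫⁻ Y, ENNReal.ofReal (f Y) ∂(observationLaw p σ (θ ω)) :=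
          mul_meas_ge_le_lintegral hfm.ennreal_ofReal _
      _ ≤ _ := lintegral_mono fun Y => ENNReal.ofReal_le_ofReal (hnorm _)

theorem corollary2 :
    ∃ C : ℝ, 0 < C ∧
      ∀ (n m kn km sn sm : ℕ) (Dn Dm : Set ℝ) (p : unitInterval) (σ : ℝ),
        1 ≤ n → 1 ≤ m →
        sn ≤ kn → sm ≤ km →
        (sn = 0 → kn = n) → (sm = 0 → km = m) →
        ({0, 1} : Set ℝ) ⊆ Dn → ({0, 1} : Set ℝ) ⊆ Dm →
        0 < (p : ℝ) → 0 < σ →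
        (ENNReal.ofReal 0.1 ≤
          ⨅ (ϑ : Matrix (Fin n) (Fin m) ℝ → Matrix (Fin n) (Fin m) ℝ) (_ : Measurable ϑ),
            ⨆ θ ∈ structuredClass Dn Dm n m kn km sn sm,
              observationLaw p σ θ
                {Y | C * σ ^ 2 / (p : ℝ) * ((max n m : ℕ) : ℝ) ≤ specNorm (ϑ Y - θ) ^ 2}) ∧
        (ENNReal.ofReal (C * σ ^ 2 / (p : ℝ) * ((max n m : ℕ) : ℝ)) ≤
          ⨅ (ϑ : Matrix (Fin n) (Fin m) ℝ → Matrix (Fin n) (Fin m) ℝ) (_ : Measurable ϑ),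
            ⨆ θ ∈ structuredClass Dn Dm n m kn km sn sm,
              ∫⁻ Y, ENNReal.ofReal (specNorm (ϑ Y - θ) ^ 2) ∂(observationLaw p σ θ)) := by
  refine ⟨1 / 5000, by norm_num, ?_⟩
  intro n m kn km sn sm Dn Dm p σ hn hm hsn hsm hn0 hm0 hDn hDm hp hσ
  have mem := indicator_mem_structuredClass hsn hsm hn0 hm0 hDn hDm (σ / (4 * √(p : ℝ)))
  have : NeZero n := ⟨by lia⟩
  have : NeZero m := ⟨by lia⟩
  -- The hypercube is placed in the first column if `m ≤ n`, and in the first row otherwise.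
  rcases le_total m n with h | h
  · have key := minimax_of_hypercube hp hσ (fun i : Fin n => (i, (0 : Fin m)))
      (fun ω => Matrix.of fun i j => if ω i && decide (j = 0) then σ / (4 * √(p : ℝ)) else 0)
      (fun ω => mem ω fun j => decide (j = 0)) (fun A => sum_col_sq_le_specNorm_sq A 0)
      (fun ω k => by simp) (fun ω k i j hij => by
        rcases eq_or_ne i k with rfl | hi
        · have : j ≠ 0 := fun hj => hij (by rw [hj])
          simp [this]
        · simp [hi])
    rw [max_eq_left h]
    simpa only [Fintype.card_fin] using key
  · have key := minimax_of_hypercube hp hσ (fun j : Fin m => ((0 : Fin n), j))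
      (fun ω => Matrix.of fun i j => if decide (i = 0) && ω j then σ / (4 * √(p : ℝ)) else 0)
      (fun ω => mem (fun i => decide (i = 0)) ω) (fun A => sum_row_sq_le_specNorm_sq A 0)
      (fun ω k => by simp) (fun ω k i j hij => by
        rcases eq_or_ne j k with rfl | hj
        · have : i ≠ 0 := fun hi => hij (by rw [hi])
          simp [this]
        · simp [hj])
    rw [max_eq_right h]
    simpa only [Fintype.card_fin] using key
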